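/- A \emph{left Ehresmann monoid}, regarded as a unary monoid, is a monoid $M$ with a unary operation $a\mapsto a^+$ satisfying the identities $$a^+a=a,\qquad a^+b^+=b^+a^+,\qquad (a^+b^+)^+=a^+b^+,\qquad (ab^+)^+=(ab)^+ .$$ For a set $X$, let $\mathrm{FLAd}(X)$ be the free left Ehresmann monoid on $X$, that is, the free object on $X$ in the variety of unary monoids defined by these identities. For a monoid $S$, a right $S$-act is \emph{finitely presented} if it is isomorphic to $F/\rho$, where $F=Y\times S$ is the free right $S$-act on a finite set $Y$, with action $(y,s)t=(y,st)$, and $\rho$ is a finitely generated congruence of right $S$-acts on $F$. The monoid $S$ is \emph{weakly right coherent} if every finitely generated right ideal of $S$ is finitely presented as a right $S$-act; \emph{weakly left coherent} is defined dually, with left ideals and left $S$-acts. \textbf{Theorem.} For every set $X$, the free left Ehresmann monoid $\mathrm{FLAd}(X)$, regarded as a monoid, is both weakly left coherent and weakly right coherent. -/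

import Mathlib

universe u v

/-! ### Acts over a monoid and weak coherence

A left act over a monoid `S` is a `MulAction S A`; a right act over `S` is a `MulAction Sᵐᵒᵖ A`, with
`MulOpposite.op s • a` standing for `a s`. Subacts are `SubMulAction`s and act congruences are
`SMulCon`s. -/

section Acts

/-- `ρ` is the act congruence generated by the set of pairs `Y`: the smallest act congruence
containing `Y`. -/
def SMulCon.IsGeneratedBy {R : Type u} {A : Type v} [SMul R A]
    (ρ : SMulCon R A) (Y : Set (A × A)) : Prop :=
  (∀ p ∈ Y, ρ.r p.1 p.2) ∧
    ∀ σ : SMulCon R A, (∀ p ∈ Y, σ.r p.1 p.2) → ∀ a b : A, ρ.r a b → σ.r a b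

/-- An act congruence is finitely generated if it is generated by a finite set of pairs. -/
def SMulCon.FinitelyGenerated {R : Type u} {A : Type v} [SMul R A] (ρ : SMulCon R A) : Prop :=
  ∃ Y : Set (A × A), Y.Finite ∧ ρ.IsGeneratedBy Y

/-- The free `R`-act of rank `n`: pairs `(i, s)` with `i < n` and `s ∈ R`, with the action
`r • (i, s) = (i, r * s)`. -/
abbrev FreeAct (R : Type u) (n : ℕ) : Type u := Σ _ : Fin n, R

/-- An `R`-act is finitely presented if it is isomorphic to a quotient of a free act of finite rank
by a finitely generated congruence. -/
def FinitelyPresentedAct (R : Type u) (A : Type v) [Monoid R] [MulAction R A] : Prop :=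
  ∃ (n : ℕ) (ρ : SMulCon R (FreeAct R n)), ρ.FinitelyGenerated ∧
    ∃ φ : A →[R] ρ.Quotient, Function.Bijective φ

/-- Every finitely generated left ideal of `S` (the empty one included) is finitely presented as a
left `S`-act. -/
def WeaklyLeftCoherent (S : Type u) [Monoid S] : Prop :=
  ∀ I : SubMulAction S S, I.FG → FinitelyPresentedAct S I

/-- Every finitely generated right ideal of `S` (the empty one included) is finitely presented as a
right `S`-act. -/
def WeaklyRightCoherent (S : Type u) [Monoid S] : Prop :=
  ∀ I : SubMulAction Sᵐᵒᵖ S, I.FG → FinitelyPresentedAct Sᵐᵒᵖ I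

end Acts

/-! ### Left Ehresmann monoids -/

/-- A left Ehresmann monoid, as a monoid with an additional unary operation `a ↦ a⁺`
satisfying identities; see `leftEhresmann_identities_iff` for the description through the relation
`RTilde E`, where `E` is the semilattice of projections. -/
class LeftEhresmannMonoid (M : Type u) extends Monoid M where
  /-- The unary operation `a ↦ a⁺`. -/
  plus : M → M
  plus_mul_self : ∀ a : M, plus a * a = a
  plus_mul_comm : ∀ a b : M, plus a * plus b = plus b * plus a
  plus_plus_mul_plus : ∀ a b : M, plus (plus a * plus b) = plus a * plus b
  plus_mul_plus : ∀ a b : M, plus (a * plus b) = plus (a * b)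

/-- `a` and `b` have the same left identities from `E`. -/
def RTilde {M : Type u} [Monoid M] (E : Set M) (a b : M) : Prop :=
  ∀ e ∈ E, e * a = a ↔ e * b = b

/-- `M` is left `E`-Ehresmann: `E` is a semilattice of idempotents, every `RTilde E`-class contains
exactly one element of `E`, and `RTilde E` is a left congruence. -/
structure IsLeftEhresmannWith {M : Type u} [Monoid M] (E : Set M) : Prop where
  idem : ∀ e ∈ E, e * e = e
  comm : ∀ e ∈ E, ∀ f ∈ E, e * f = f * e
  mul_mem : ∀ e ∈ E, ∀ f ∈ E, e * f ∈ E
  existsUnique : ∀ a : M, ∃! e : M, e ∈ E ∧ RTilde E a e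
  leftCongruence : ∀ a b c : M, RTilde E a b → RTilde E (c * a) (c * b)

/-- The identities of `LeftEhresmannMonoid` hold for a unary operation `p` on a monoid exactly if
the monoid is left `E`-Ehresmann for some `E`, with `p a` the element of `E` in the class of `a`. -/
theorem leftEhresmann_identities_iff {M : Type u} [Monoid M] (p : M → M) :
    ((∀ a, p a * a = a) ∧ (∀ a b, p a * p b = p b * p a) ∧
      (∀ a b, p (p a * p b) = p a * p b) ∧ (∀ a b, p (a * p b) = p (a * b))) ↔
    ∃ E : Set M, IsLeftEhresmannWith E ∧ ∀ a, p a ∈ E ∧ RTilde E a (p a) := by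
  constructor
  · rintro ⟨h1, h2, h3, h4⟩
    have hpp : ∀ a, p (p a) = p a := fun a => by simpa using h4 1 a
    have hid : ∀ a, p a * p a = p a := fun a => by simpa [hpp] using h1 (p a)
    have hR : ∀ a, RTilde (Set.range p) a (p a) := by
      rintro a _ ⟨b, rfl⟩
      constructor
      · intro h
        have := h4 (p b) a
        rwa [h3, h] at this
      · intro h
        rw [← h1 a, ← mul_assoc, h]
    have hEq : ∀ a b, RTilde (Set.range p) a b → p a = p b := by
      intro a b h
      have e1 : p a * p b = p b := (hR b _ ⟨a, rfl⟩).1 ((h _ ⟨a, rfl⟩).1 (h1 a))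
      have e2 : p b * p a = p a := (hR a _ ⟨b, rfl⟩).1 ((h _ ⟨b, rfl⟩).2 (h1 b))
      rw [← e2, ← h2, e1]
    have hEq' : ∀ a b, p a = p b → RTilde (Set.range p) a b := by
      intro a b h e he
      rw [hR a e he, hR b e he, h]
    refine ⟨Set.range p, ⟨?_, ?_, ?_, ?_, ?_⟩, fun a => ⟨⟨a, rfl⟩, hR a⟩⟩
    · rintro _ ⟨a, rfl⟩; exact hid a
    · rintro _ ⟨a, rfl⟩ _ ⟨b, rfl⟩; exact h2 a b
    · rintro _ ⟨a, rfl⟩ _ ⟨b, rfl⟩; exact ⟨_, h3 a b⟩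
    · intro a
      refine ⟨p a, ⟨⟨a, rfl⟩, hR a⟩, ?_⟩
      rintro _ ⟨⟨b, rfl⟩, h⟩
      rw [hEq _ _ h, hpp]
    · intro a b c h
      apply hEq'
      rw [← h4 c a, ← h4 c b, hEq a b h]
  · rintro ⟨E, hE, hp⟩
    have hid : ∀ a, p a * p a = p a := fun a => hE.idem _ (hp a).1
    have huniq : ∀ a e, e ∈ E → RTilde E a e → p a = e := fun a e he h =>
      (hE.existsUnique a).unique (hp a) ⟨he, h⟩
    refine ⟨fun a => ((hp a).2 _ (hp a).1).2 (hid a),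
      fun a b => hE.comm _ (hp a).1 _ (hp b).1, fun a b => ?_, fun a b => ?_⟩
    · exact huniq _ _ (hE.mul_mem _ (hp a).1 _ (hp b).1) fun e _ => Iff.rfl
    · refine huniq _ _ (hp _).1 fun e he => ?_
      rw [← hE.leftCongruence _ _ a (hp b).2 e he]
      exact (hp (a * b)).2 e he

/-! ### The free left Ehresmann monoid -/

/-- Terms over `X` in the signature of unary monoids. -/
inductive UnaryMonoidTerm (X : Type u) : Type u
  | of : X → UnaryMonoidTerm X
  | one : UnaryMonoidTerm X
  | mul : UnaryMonoidTerm X → UnaryMonoidTerm X → UnaryMonoidTerm X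
  | plus : UnaryMonoidTerm X → UnaryMonoidTerm X

namespace UnaryMonoidTerm

/-- The least congruence on terms for which the quotient is a left Ehresmann monoid. -/
inductive Rel {X : Type u} : UnaryMonoidTerm X → UnaryMonoidTerm X → Prop
  | refl (a) : Rel a a
  | symm {a b} : Rel a b → Rel b a
  | trans {a b c} : Rel a b → Rel b c → Rel a c
  | mul_congr {a a' b b'} : Rel a a' → Rel b b' → Rel (mul a b) (mul a' b')
  | plus_congr {a a'} : Rel a a' → Rel (plus a) (plus a')
  | mul_assoc (a b c) : Rel (mul (mul a b) c) (mul a (mul b c))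
  | one_mul (a) : Rel (mul one a) a
  | mul_one (a) : Rel (mul a one) a
  | plus_mul_self (a) : Rel (mul (plus a) a) a
  | plus_mul_comm (a b) : Rel (mul (plus a) (plus b)) (mul (plus b) (plus a))
  | plus_plus_mul_plus (a b) :
      Rel (plus (mul (plus a) (plus b))) (mul (plus a) (plus b))
  | plus_mul_plus (a b) : Rel (plus (mul a (plus b))) (plus (mul a b))

/-- `Rel` as a setoid. -/
def relSetoid (X : Type u) : Setoid (UnaryMonoidTerm X) :=
  ⟨Rel, Rel.refl, Rel.symm, Rel.trans⟩

/-- The value of a term in a left Ehresmann monoid. -/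
def eval {X : Type u} {N : Type v} [LeftEhresmannMonoid N] (f : X → N) : UnaryMonoidTerm X → N
  | of x => f x
  | one => 1
  | mul a b => eval f a * eval f b
  | plus a => LeftEhresmannMonoid.plus (eval f a)

theorem eval_eq_of_rel {X : Type u} {N : Type v} [LeftEhresmannMonoid N] (f : X → N)
    {a b : UnaryMonoidTerm X} (h : Rel a b) : eval f a = eval f b := by
  induction h with
  | refl => rfl
  | symm _ ih => exact ih.symm
  | trans _ _ ih₁ ih₂ => exact ih₁.trans ih₂
  | mul_congr _ _ ih₁ ih₂ => simp only [eval, ih₁, ih₂]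
  | plus_congr _ ih => simp only [eval, ih]
  | mul_assoc => exact _root_.mul_assoc _ _ _
  | one_mul => exact _root_.one_mul _
  | mul_one => exact _root_.mul_one _
  | plus_mul_self => exact LeftEhresmannMonoid.plus_mul_self _
  | plus_mul_comm => exact LeftEhresmannMonoid.plus_mul_comm _ _
  | plus_plus_mul_plus => exact LeftEhresmannMonoid.plus_plus_mul_plus _ _
  | plus_mul_plus => exact LeftEhresmannMonoid.plus_mul_plus _ _

end UnaryMonoidTerm

/-- The free left Ehresmann monoid on `X`: the free object on `X` in the variety of unary monoids
formed by the left Ehresmann monoids (see `FLAd.existsUnique_lift`). -/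
def FLAd (X : Type u) : Type u := Quotient (UnaryMonoidTerm.relSetoid X)

namespace FLAd

open UnaryMonoidTerm

/-- The class of a term. -/
def mk {X : Type u} (a : UnaryMonoidTerm X) : FLAd X := Quotient.mk (relSetoid X) a

instance instLeftEhresmannMonoid (X : Type u) : LeftEhresmannMonoid (FLAd X) where
  mul := Quotient.map₂ UnaryMonoidTerm.mul fun _ _ h₁ _ _ h₂ => Rel.mul_congr h₁ h₂
  one := Quotient.mk (relSetoid X) UnaryMonoidTerm.one
  plus := Quotient.map UnaryMonoidTerm.plus fun _ _ h => Rel.plus_congr h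
  mul_assoc := by
    rintro ⟨a⟩ ⟨b⟩ ⟨c⟩; exact Quotient.sound (s := relSetoid X) (Rel.mul_assoc a b c)
  one_mul := by rintro ⟨a⟩; exact Quotient.sound (s := relSetoid X) (Rel.one_mul a)
  mul_one := by rintro ⟨a⟩; exact Quotient.sound (s := relSetoid X) (Rel.mul_one a)
  plus_mul_self := by rintro ⟨a⟩; exact Quotient.sound (s := relSetoid X) (Rel.plus_mul_self a)
  plus_mul_comm := by
    rintro ⟨a⟩ ⟨b⟩; exact Quotient.sound (s := relSetoid X) (Rel.plus_mul_comm a b)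
  plus_plus_mul_plus := by
    rintro ⟨a⟩ ⟨b⟩; exact Quotient.sound (s := relSetoid X) (Rel.plus_plus_mul_plus a b)
  plus_mul_plus := by
    rintro ⟨a⟩ ⟨b⟩; exact Quotient.sound (s := relSetoid X) (Rel.plus_mul_plus a b)

/-- The canonical map from `X` to the free left Ehresmann monoid. -/
def of {X : Type u} (x : X) : FLAd X := mk (UnaryMonoidTerm.of x)

/-- The universal property of the free left Ehresmann monoid. -/
theorem existsUnique_lift {X : Type u} {N : Type v} [LeftEhresmannMonoid N] (f : X → N) :
    ∃! φ : FLAd X →* N,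
      (∀ a, φ (LeftEhresmannMonoid.plus a) = LeftEhresmannMonoid.plus (φ a)) ∧
        ∀ x, φ (of x) = f x := by
  refine ⟨⟨⟨Quotient.lift (eval f) fun _ _ h => eval_eq_of_rel f h, rfl⟩, ?_⟩, ⟨?_, ?_⟩, ?_⟩
  · rintro ⟨a⟩ ⟨b⟩; rfl
  · rintro ⟨a⟩; rfl
  · intro x; rfl
  · rintro ψ ⟨h₁, h₂⟩
    ext a
    induction a using Quotient.inductionOn with | _ a => ?_
    change ψ (mk a) = eval f a
    induction a with
    | of x => exact h₂ x
    | one => exact map_one ψ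
    | mul a b iha ihb =>
      exact (map_mul ψ (mk a) (mk b)).trans (congrArg₂ (· * ·) iha ihb)
    | plus a iha => exact (h₁ (mk a)).trans (congrArg LeftEhresmannMonoid.plus iha)

end FLAd

/-!
By a criterion of Gould, it is enough that for the actions of the monoid `M` on itself from the
left and from the right the annihilator congruences of elements and the intersections of principal
ideals are finitely generated.

The elements of `M` have normal forms `f₀ x₁ f₁ ⋯ xₙ fₙ`, where the `xᵢ` are letters and the `fᵢ`
are projections with `fᵢ₋₁ ≤ (xᵢ fᵢ)⁺`. The projections form the free semilattice with a top element
and monotone operations `e ↦ (x e)⁺`, in which `e f ≤ (x g)⁺` only if `e ≤ (x g)⁺` or `f ≤ (x g)⁺`.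

* Cancelling letters one at a time shows that `u a = v a` implies `u a⁺ = v a⁺`, and that
  `a u = a v` implies `fₙ u = fₙ v` for the last projection `fₙ` of `a`. So every annihilator
  congruence is generated by one pair.
* If `u a = v b` with `a` not longer than `b`, then either `b ∈ M a`, and so `M a ∩ M b = M b`, or
  `a = a⁺ r` and `b = b⁺ r` for a common `r`, and then `M a ∩ M b` is generated by `b⁺ a = a⁺ b`.
* If `a` is not longer than `b`, then `b v ∈ a M` depends only on the projection `v⁺`, and the `v⁺`
  for which it holds are the projections below some `q`, if there are any. Then `a M ∩ b M` is
  generated by `b q`.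
-/

/-! ### Gould's criterion for finite presentability -/

section Criterion

variable {R R' A A' : Type*} [Monoid R] [Monoid R'] [MulAction R A] [MulAction R' A']

theorem mem_closure_iff_exists_smul {s : Set A} {x : A} :
    x ∈ SubMulAction.closure R s ↔ ∃ r : R, ∃ a ∈ s, r • a = x := by
  constructor
  · let J : SubMulAction R A :=
      { carrier := {x | ∃ r : R, ∃ a ∈ s, r • a = x}
        smul_mem' := by
          rintro r _ ⟨t, a, ha, rfl⟩
          exact ⟨r * t, a, ha, mul_smul r t a⟩ }
    have hJ : SubMulAction.closure R s ≤ J :=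
      SubMulAction.closure_le.2 fun a ha => ⟨1, a, ha, one_smul R a⟩
    exact fun hx => hJ hx
  · rintro ⟨r, a, ha, rfl⟩
    exact SubMulAction.smul_mem _ r (SubMulAction.subset_closure ha)

theorem mem_inf_closure_singleton_iff {a b x : A} :
    x ∈ SubMulAction.closure R {a} ⊓ SubMulAction.closure R {b} ↔
      ∃ u v : R, u • a = x ∧ v • b = x := by
  change x ∈ SubMulAction.closure R {a} ∧ x ∈ SubMulAction.closure R {b} ↔ _
  simp only [mem_closure_iff_exists_smul, Set.mem_singleton_iff, exists_eq_left, exists_and_left,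
    exists_and_right]

/-- The preimage of an act congruence under an equivariant map. -/
def comapCon {φ : R → R'} (f : A →ₑ[φ] A') (σ : SMulCon R' A') : SMulCon R A where
  __ := σ.toSetoid.comap f
  smul r x y h := by
    change σ.r (f (r • x)) (f (r • y))
    simpa only [map_smulₛₗ] using σ.smul (φ r) h

/-- The annihilator congruence `{(u, v) | u • a = v • a}` of an element of an act. -/
def annihilatorCon (R : Type*) {A : Type*} [Monoid R] [MulAction R A] (a : A) : SMulCon R R :=
  SMulCon.ker (⟨fun r => r • a, fun r s => mul_smul r s a⟩ : R →[R] A)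

/-- All annihilator congruences of elements of the act are finitely generated. -/
def FinitelyEquated (R A : Type*) [Monoid R] [MulAction R A] : Prop :=
  ∀ a : A, (annihilatorCon R a).FinitelyGenerated

/-- The Howson property, that finitely generated subacts have finitely generated intersections.
It is required of cyclic subacts only, because finitely generated subacts are finite unions of
cyclic ones. -/
def HowsonAct (R A : Type*) [Monoid R] [MulAction R A] : Prop :=
  ∀ a b : A, (SubMulAction.closure R {a} ⊓ SubMulAction.closure R {b}).FG

namespace FreeAct

/-- The inclusion of the `i`-th copy of `R` into the free act. -/
def incl {n : ℕ} (i : Fin n) : R →[R] FreeAct R n where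
  toFun s := ⟨i, s⟩
  map_smul' _ _ := rfl

/-- The equivariant map from the free act that sends the `i`-th free generator to `a i`. -/
def lift {n : ℕ} (a : Fin n → A) : FreeAct R n →[R] A where
  toFun x := x.2 • a x.1
  map_smul' r x := mul_smul r x.2 (a x.1)

theorem range_lift {n : ℕ} (a : Fin n → A) :
    Set.range (lift (R := R) a) = SubMulAction.closure R (Set.range a) := by
  ext x
  rw [SetLike.mem_coe, mem_closure_iff_exists_smul]
  constructor
  · rintro ⟨⟨i, r⟩, rfl⟩
    exact ⟨r, a i, ⟨i, rfl⟩, rfl⟩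
  · rintro ⟨r, _, ⟨i, rfl⟩, rfl⟩
    exact ⟨⟨i, r⟩, rfl⟩

theorem ker_lift_finitelyGenerated (hE : FinitelyEquated R A) (hH : HowsonAct R A) {n : ℕ}
    (a : Fin n → A) : (SMulCon.ker (lift (R := R) a)).FinitelyGenerated := by
  choose Y hYfin hYrel hYmin using fun i => hE (a i)
  choose T hTfin hT using fun i j => hH (a i) (a j)
  have hTmem : ∀ i j, ∀ t ∈ T i j, ∃ p q : R, p • a i = t ∧ q • a j = t := fun i j t ht =>
    mem_inf_closure_singleton_iff.1 (hT i j ▸ SubMulAction.subset_closure ht)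
  choose! p q hp hq using hTmem
  refine ⟨(⋃ i, Prod.map (incl i) (incl i) '' Y i) ∪
      ⋃ i, ⋃ j, (fun t => (incl i (p i j t), incl j (q i j t))) '' T i j,
    (Set.finite_iUnion fun i => (hYfin i).image _).union
      (Set.finite_iUnion fun i => Set.finite_iUnion fun j => (hTfin i j).image _), ?_, ?_⟩
  · simp only [Set.mem_union, Set.mem_iUnion]
    rintro _ (⟨i, y, hy, rfl⟩ | ⟨i, j, t, ht, rfl⟩)
    · exact hYrel i y hy
    · change p i j t • a i = q i j t • a j
      exact (hp i j t ht).trans (hq i j t ht).symm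
  · simp only [Set.mem_union, Set.mem_iUnion]
    rintro σ hσ ⟨i, u⟩ ⟨j, v⟩ (huv : u • a i = v • a j)
    change σ.r (incl i u) (incl j v)
    have same_generator (i) (u v : R) (h : u • a i = v • a i) : σ.r (incl i u) (incl i v) :=
      hYmin i (comapCon (incl i) σ) (fun y hy => hσ _ (.inl ⟨i, y, hy, rfl⟩)) u v h
    obtain ⟨r, t, ht, hrt⟩ : ∃ r : R, ∃ t ∈ T i j, r • t = u • a i := by
      rw [← mem_closure_iff_exists_smul, ← hT, mem_inf_closure_singleton_iff]
      exact ⟨u, v, rfl, huv.symm⟩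
    have hu : σ.r (incl i u) (incl i (r * p i j t)) :=
      same_generator i _ _ (by rw [mul_smul, hp i j t ht, hrt])
    have hv : σ.r (incl j (r * q i j t)) (incl j v) :=
      same_generator j _ _ (by rw [mul_smul, hq i j t ht, hrt, huv])
    have hpq : σ.r (incl i (r * p i j t)) (incl j (r * q i j t)) :=
      σ.smul r (hσ _ (.inr ⟨i, j, t, ht, rfl⟩))
    exact σ.iseqv.trans hu (σ.iseqv.trans hpq hv)

end FreeAct

theorem finitelyPresentedAct_of_range_eq {n : ℕ} (f : FreeAct R n →[R] A) {I : SubMulAction R A}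
    (hI : Set.range f = I) (hf : (SMulCon.ker f).FinitelyGenerated) :
    FinitelyPresentedAct R I := by
  let e : (SMulCon.ker f).Quotient ≃ I :=
    (Setoid.quotientKerEquivRange f).trans (Equiv.setCongr hI)
  have he (r : R) (x : (SMulCon.ker f).Quotient) : e (r • x) = r • e x := by
    induction x using Quotient.inductionOn
    exact Subtype.ext (map_smul f r _)
  exact ⟨n, SMulCon.ker f, hf, ⟨e.symm, fun r x => e.injective (by simp [he])⟩, e.symm.bijective⟩

theorem finitelyPresentedAct_of_finitelyEquated_of_howsonAct (hE : FinitelyEquated R A)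
    (hH : HowsonAct R A) {I : SubMulAction R A} (hI : I.FG) : FinitelyPresentedAct R I := by
  obtain ⟨s, rfl⟩ := SubMulAction.fg_iff.1 hI
  let a : Fin s.card → A := fun i => s.equivFin.symm i
  have hrange : Set.range a = s :=
    (s.equivFin.symm.surjective.range_comp _).trans Subtype.range_coe
  refine finitelyPresentedAct_of_range_eq (FreeAct.lift a) ?_
    (FreeAct.ker_lift_finitelyGenerated hE hH a)
  rw [FreeAct.range_lift, hrange]

theorem FinitelyEquated.of_injective (e : R ≃* R') (f : A →ₑ[e] A') (hf : Function.Injective f)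
    (h : FinitelyEquated R' A') : FinitelyEquated R A := by
  intro a
  obtain ⟨Y, hYfin, hYrel, hYmin⟩ := h (f a)
  have annihilator_iff (u v : R) : u • a = v • a ↔ e u • f a = e v • f a := by
    rw [← map_smulₛₗ, ← map_smulₛₗ, hf.eq_iff]
  refine ⟨Prod.map e.symm e.symm '' Y, hYfin.image _, ?_, fun σ hσ u v huv => ?_⟩
  · rintro _ ⟨y, hy, rfl⟩
    have hy' : y.1 • f a = y.2 • f a := hYrel y hy
    refine (annihilator_iff _ _).2 ?_
    simpa only [Prod.map_fst, Prod.map_snd, e.apply_symm_apply] using hy'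
  · let g : R' →ₑ[e.symm] R := ⟨e.symm, map_mul e.symm⟩
    have : σ.r (e.symm (e u)) (e.symm (e v)) :=
      hYmin (comapCon g σ) (fun y hy => hσ _ ⟨y, hy, rfl⟩) _ _ ((annihilator_iff u v).1 huv)
    simpa using this

theorem HowsonAct.of_injective (e : R ≃* R') (f : A →ₑ[e] A') (hf : Function.Injective f)
    (h : HowsonAct R' A') : HowsonAct R A := by
  intro a b
  have map_mem_iff (s : Set A) (x : A) :
      f x ∈ SubMulAction.closure R' (f '' s) ↔ x ∈ SubMulAction.closure R s := by
    simp only [mem_closure_iff_exists_smul, Set.exists_mem_image, e.surjective.exists,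
      ← map_smulₛₗ, hf.eq_iff]
  obtain ⟨T, hTfin, hT⟩ := h (f a) (f b)
  have hTrange : T ⊆ Set.range f := fun t ht => by
    obtain ⟨r', -, rfl, -⟩ := mem_inf_closure_singleton_iff.1 (hT ▸ SubMulAction.subset_closure ht)
    exact ⟨e.symm r' • a, by rw [map_smulₛₗ, e.apply_symm_apply]⟩
  refine ⟨f ⁻¹' T, hTfin.preimage hf.injOn, SetLike.ext fun x => ?_⟩
  rw [← map_mem_iff, Set.image_preimage_eq_of_subset hTrange, ← hT, ← Set.image_singleton,
    ← Set.image_singleton]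
  exact and_congr (map_mem_iff _ x).symm (map_mem_iff _ x).symm

theorem annihilatorCon_finitelyGenerated {a : A} {e : R} (he : e • a = a)
    (h : ∀ u v : R, u • a = v • a → u * e = v * e) : (annihilatorCon R a).FinitelyGenerated := by
  refine ⟨{(1, e)}, Set.finite_singleton _, ?_, fun σ hσ u v huv => ?_⟩
  · rintro _ rfl
    exact (one_smul R a).trans he.symm
  · have mul_right (w : R) : σ.r w (w * e) := by simpa using σ.smul w (hσ _ rfl)
    exact σ.trans (mul_right u) (h u v huv ▸ σ.symm (mul_right v))

theorem inf_closure_singleton_fg {a b : A} (h : (∃ u v : R, u • a = v • b) →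
      ∃ p q : R, p • a = q • b ∧ ∀ u v : R, u • a = v • b → ∃ t : R, t • p • a = u • a) :
    (SubMulAction.closure R {a} ⊓ SubMulAction.closure R {b}).FG := by
  by_cases hab : ∃ u v : R, u • a = v • b
  · obtain ⟨p, q, hpq, hp⟩ := h hab
    refine ⟨{p • a}, Set.finite_singleton _, le_antisymm (fun x hx => ?_) ?_⟩
    · obtain ⟨u, v, rfl, hv⟩ := mem_inf_closure_singleton_iff.1 hx
      obtain ⟨t, ht⟩ := hp u v hv.symm
      exact mem_closure_iff_exists_smul.2 ⟨t, _, rfl, ht⟩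
    · rw [SubMulAction.closure_le, Set.singleton_subset_iff]
      exact mem_inf_closure_singleton_iff.2 ⟨p, q, rfl, hpq.symm⟩
  · refine ⟨∅, Set.finite_empty, le_antisymm (fun x hx => ?_) ?_⟩
    · obtain ⟨u, v, hu, hv⟩ := mem_inf_closure_singleton_iff.1 hx
      exact (hab ⟨u, v, hu.trans hv.symm⟩).elim
    · exact SubMulAction.closure_le.2 (Set.empty_subset _)

end Criterion

/-! ### The semilattice of projections -/

namespace LeftEhresmannMonoid

section Projections

variable {M : Type*} [LeftEhresmannMonoid M]

theorem plus_plus (a : M) : plus (plus a) = plus a := by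
  simpa only [one_mul] using plus_mul_plus 1 a

theorem plus_one : plus (1 : M) = 1 := by
  simpa only [mul_one] using plus_mul_self (1 : M)

theorem plus_mul_of_plus_eq {e : M} (he : plus e = e) (a : M) : plus (e * a) = e * plus a := by
  rw [← plus_mul_plus, ← he, plus_plus_mul_plus]

theorem mul_comm_of_plus_eq {e f : M} (he : plus e = e) (hf : plus f = f) : e * f = f * e := by
  rw [← he, ← hf, plus_mul_comm]

theorem mul_self_of_plus_eq {e : M} (he : plus e = e) : e * e = e := by
  simpa only [he] using plus_mul_self e

variable (M) in
/-- The projections of a left Ehresmann monoid: the elements of the form `a⁺`, equivalently those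
fixed by `⁺`. They form a semilattice under multiplication. -/
def Projection : Type _ := {e : M // plus e = e}

namespace Projection

instance : Min (Projection M) where
  min e f := ⟨e.1 * f.1, by rw [plus_mul_of_plus_eq e.2, f.2]⟩

instance : SemilatticeInf (Projection M) :=
  SemilatticeInf.mk' (fun e f => Subtype.ext (mul_comm_of_plus_eq e.2 f.2))
    (fun e f g => Subtype.ext (mul_assoc e.1 f.1 g.1))
    (fun e => Subtype.ext (mul_self_of_plus_eq e.2))

theorem val_inf (e f : Projection M) : (e ⊓ f).1 = e.1 * f.1 := rfl

instance : OrderTop (Projection M) where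
  top := ⟨1, plus_one⟩
  le_top e := inf_eq_left.1 (Subtype.ext (mul_one e.1))

/-- The monotone action `e ↦ (a e)⁺` of a left Ehresmann monoid on its projections. -/
def act (a : M) : Projection M →o Projection M where
  toFun e := ⟨plus (a * e.1), plus_plus _⟩
  monotone' e f hef := by
    have he : e.1 = f.1 * e.1 := congrArg Subtype.val (inf_eq_right.2 hef).symm
    refine inf_eq_right.1 (Subtype.ext ?_)
    change plus (a * f.1) * plus (a * e.1) = plus (a * e.1)
    rw [← plus_mul_of_plus_eq (plus_plus _), he, ← mul_assoc a, ← mul_assoc (plus _),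
      plus_mul_self]

end Projection

theorem mul_plus_mul_eq_of_mul_eq_mul {a b r u v : M}
    (hcancel : ∀ u v : M, u * r = v * r → u * plus r = v * plus r)
    (ha : plus a * r = a) (hb : plus b * r = b) (huv : u * a = v * b) :
    u * (plus b * a) = u * a := by
  have plus_mul_plus_eq {c : M} (hc : plus c * r = c) : plus c * plus r = plus c := by
    rw [← plus_mul_of_plus_eq (plus_plus c), hc]
  have hplus : u * plus a = v * plus b := by
    have := hcancel (u * plus a) (v * plus b) (by rw [mul_assoc, mul_assoc, ha, hb, huv])
    rwa [mul_assoc, mul_assoc, plus_mul_plus_eq ha, plus_mul_plus_eq hb] at this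
  calc u * (plus b * a) = u * plus a * plus b * a := by
        rw [mul_assoc u, plus_mul_comm, mul_assoc u, mul_assoc (plus b), plus_mul_self]
    _ = v * b := by
        rw [hplus, mul_assoc v, mul_self_of_plus_eq (plus_plus b), ← hplus, mul_assoc,
          plus_mul_self, huv]
    _ = u * a := huv.symm

end Projections

end LeftEhresmannMonoid

/-! ### The free semilattice with top and a family of monotone operations -/

/-- Terms for the elements of the free semilattice with a top element and one monotone operation
for each letter. -/
inductive ProjTerm (X : Type*)
  | top : ProjTerm X
  | inf : ProjTerm X → ProjTerm X → ProjTerm X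
  | op : X → ProjTerm X → ProjTerm X

namespace ProjTerm

variable {X : Type*}

/-- The order on terms, by rules without transitivity: this makes the inequalities
`e ≤ op x f` decomposable. -/
inductive Le : ProjTerm X → ProjTerm X → Prop
  | top (e) : Le e top
  | inf {e f g} : Le e f → Le e g → Le e (inf f g)
  | inf_left {e g x} (f) : Le e (op x g) → Le (inf e f) (op x g)
  | inf_right {f g x} (e) : Le f (op x g) → Le (inf e f) (op x g)
  | op {e f} (x) : Le e f → Le (op x e) (op x f)

namespace Le

variable {e f g : ProjTerm X}

theorem of_left (f : ProjTerm X) (h : Le e g) : Le (.inf e f) g := by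
  induction h with
  | top => exact .top _
  | inf _ _ ih₁ ih₂ => exact .inf ih₁ ih₂
  | inf_left _ h => exact .inf_left f (.inf_left _ h)
  | inf_right _ h => exact .inf_left f (.inf_right _ h)
  | op x h => exact .inf_left f (.op x h)

theorem of_right (e : ProjTerm X) (h : Le f g) : Le (.inf e f) g := by
  induction h with
  | top => exact .top _
  | inf _ _ ih₁ ih₂ => exact .inf ih₁ ih₂
  | inf_left _ h => exact .inf_right e (.inf_left _ h)
  | inf_right _ h => exact .inf_right e (.inf_right _ h)
  | op x h => exact .inf_right e (.op x h)

theorem refl (e : ProjTerm X) : Le e e := by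
  induction e with
  | top => exact .top _
  | inf e f he hf => exact .inf (he.of_left f) (hf.of_right e)
  | op x e he => exact .op x he

theorem op_mono_right {x : X} (hfg : ∀ e, Le e f → Le e g) (h : Le e (.op x f)) :
    Le e (.op x g) := by
  induction e with
  | top => cases h
  | inf e₁ e₂ ih₁ ih₂ =>
    cases h with
    | inf_left _ h => exact .inf_left _ (ih₁ h)
    | inf_right _ h => exact .inf_right _ (ih₂ h)
  | op y e =>
    cases h with
    | op _ h => exact .op _ (hfg _ h)

theorem trans (hef : Le e f) (hfg : Le f g) : Le e g := by
  induction hfg generalizing e with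
  | top => exact .top _
  | inf _ _ ih₁ ih₂ => exact .inf (ih₁ hef) (ih₂ hef)
  | inf_left _ _ ih =>
    cases hef with
    | inf h _ => exact ih h
  | inf_right _ _ ih =>
    cases hef with
    | inf _ h => exact ih h
  | op _ _ ih => exact hef.op_mono_right fun _ => ih

end Le

instance : Preorder (ProjTerm X) where
  le := Le
  le_refl := Le.refl
  le_trans _ _ _ := Le.trans

/-- The value of a term in a semilattice with a top element and monotone operations `φ x`. -/
def eval {L : Type*} [SemilatticeInf L] [OrderTop L] (φ : X → L →o L) : ProjTerm X → L
  | top => ⊤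
  | inf e f => e.eval φ ⊓ f.eval φ
  | op x e => φ x (e.eval φ)

theorem eval_mono {L : Type*} [SemilatticeInf L] [OrderTop L] (φ : X → L →o L) :
    Monotone (eval φ) := by
  intro e f h
  induction (h : Le e f) with
  | top => exact le_top
  | inf _ _ ih₁ ih₂ => exact le_inf ih₁ ih₂
  | inf_left _ _ ih => exact inf_le_left.trans ih
  | inf_right _ _ ih => exact inf_le_right.trans ih
  | op x _ ih => exact (φ x).monotone ih

end ProjTerm

/-- The free semilattice with a top element and one monotone operation for each letter. -/
def Proj (X : Type*) : Type _ := Antisymmetrization (ProjTerm X) (· ≤ ·)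

namespace Proj

variable {X : Type*}

instance : PartialOrder (Proj X) :=
  inferInstanceAs (PartialOrder (Antisymmetrization (ProjTerm X) (· ≤ ·)))

instance : SemilatticeInf (Proj X) where
  inf := Quotient.map₂ .inf fun _ _ h₁ _ _ h₂ =>
    ⟨.inf (.of_left _ h₁.1) (.of_right _ h₂.1), .inf (.of_left _ h₁.2) (.of_right _ h₂.2)⟩
  inf_le_left := by
    rintro ⟨e⟩ ⟨f⟩
    exact .of_left f (.refl e)
  inf_le_right := by
    rintro ⟨e⟩ ⟨f⟩
    exact .of_right e (.refl f)
  le_inf := by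
    rintro ⟨e⟩ ⟨f⟩ ⟨g⟩ hf hg
    exact .inf hf hg

instance : OrderTop (Proj X) where
  top := toAntisymmetrization (· ≤ ·) .top
  le_top := by
    rintro ⟨e⟩
    exact .top e

/-- The operation of a letter; in the free left Ehresmann monoid it is `e ↦ (x e)⁺`. -/
def op (x : X) : Proj X → Proj X := Quotient.map (.op x) fun _ _ h => ⟨.op x h.1, .op x h.2⟩

theorem op_le_op_iff {x y : X} {e f : Proj X} : op x e ≤ op y f ↔ x = y ∧ e ≤ f := by
  induction e, f using Quotient.inductionOn₂ with | _ e f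
  constructor
  · intro h
    cases (h : ProjTerm.Le (.op x e) (.op y f)) with
    | op _ h => exact ⟨rfl, h⟩
  · rintro ⟨rfl, h⟩
    exact .op x h

theorem op_mono (x : X) : Monotone (op x) := fun _ _ h => op_le_op_iff.2 ⟨rfl, h⟩

theorem inf_le_op_iff {x : X} {e f g : Proj X} : e ⊓ f ≤ op x g ↔ e ≤ op x g ∨ f ≤ op x g := by
  refine ⟨?_, fun h => h.elim inf_le_left.trans inf_le_right.trans⟩
  induction e, f, g using Quotient.inductionOn₃ with | _ e f g
  intro h
  cases (h : ProjTerm.Le (.inf e f) (.op x g)) with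
  | inf_left _ h => exact .inl h
  | inf_right _ h => exact .inr h

@[elab_as_elim]
theorem induction {P : Proj X → Prop} (top : P ⊤) (inf : ∀ e f, P e → P f → P (e ⊓ f))
    (op : ∀ x e, P e → P (op x e)) (e : Proj X) : P e := by
  induction e using Quotient.inductionOn with | _ e
  induction e with
  | top => exact top
  | inf e f he hf => exact inf _ _ he hf
  | op x e he => exact op x _ he

section Lift

variable {L : Type*} [SemilatticeInf L] [OrderTop L]

/-- The homomorphism from `Proj X` to a semilattice with a top element and monotone operations
`φ x`. -/
def lift (φ : X → L →o L) : InfTopHom (Proj X) L where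
  toFun := Quotient.lift (ProjTerm.eval φ) fun _ _ h =>
    le_antisymm (ProjTerm.eval_mono φ h.1) (ProjTerm.eval_mono φ h.2)
  map_inf' e f := Quotient.inductionOn₂ e f fun _ _ => rfl
  map_top' := rfl

theorem lift_op (φ : X → L →o L) (x : X) (e : Proj X) : lift φ (op x e) = φ x (lift φ e) :=
  Quotient.inductionOn e fun _ => rfl

end Lift

end Proj

/-- The elements satisfying the predicate form the empty set or a principal ideal. -/
def EmptyOrPrincipal {L : Type*} [LE L] (P : L → Prop) : Prop :=
  (∀ h, ¬ P h) ∨ ∃ q, ∀ h, P h ↔ h ≤ q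

namespace EmptyOrPrincipal

variable {L : Type*} {P Q : L → Prop}

theorem and [SemilatticeInf L] (hP : EmptyOrPrincipal P) (hQ : EmptyOrPrincipal Q) :
    EmptyOrPrincipal fun h => P h ∧ Q h := by
  obtain hP | ⟨p, hP⟩ := hP
  · exact .inl fun h hPQ => hP h hPQ.1
  obtain hQ | ⟨q, hQ⟩ := hQ
  · exact .inl fun h hPQ => hQ h hPQ.2
  · exact .inr ⟨p ⊓ q, fun h => by simp only [hP, hQ, le_inf_iff]⟩

theorem const_or [LE L] [OrderTop L] (c : Prop) (hP : EmptyOrPrincipal P) :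
    EmptyOrPrincipal fun h => c ∨ P h := by
  by_cases hc : c
  · exact .inr ⟨⊤, by simp [hc]⟩
  · simpa only [hc, false_or] using hP

theorem const_and [LE L] (c : Prop) (hP : EmptyOrPrincipal P) :
    EmptyOrPrincipal fun h => c ∧ P h := by
  by_cases hc : c
  · simpa only [hc, true_and] using hP
  · exact .inl fun h hcP => hc hcP.1

end EmptyOrPrincipal

/-! ### Normal chains -/

/-- Sequences `(f₀, x₁, f₁, …, xₙ, fₙ)` alternating between projections and letters, standing for
the product `f₀ x₁ f₁ ⋯ xₙ fₙ`. -/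
inductive Chain (X : Type*)
  | single : Proj X → Chain X
  | cons : Proj X → X → Chain X → Chain X

namespace Chain

open Proj

variable {X : Type*}

/-- The first projection `f₀` of a chain. -/
def head : Chain X → Proj X
  | single f => f
  | cons f _ _ => f

/-- The last projection `fₙ` of a chain. -/
def final : Chain X → Proj X
  | single f => f
  | cons _ _ m => m.final

/-- The number `n` of letters of a chain. -/
def length : Chain X → ℕ
  | single _ => 0
  | cons _ _ m => m.length + 1

/-- The inequalities `fᵢ₋₁ ≤ (xᵢ fᵢ)⁺` hold throughout the chain. -/
def IsNormal : Chain X → Prop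
  | single _ => True
  | cons f x m => f ≤ op x m.head ∧ m.IsNormal

/-- The product of chains: concatenate, meeting the two projections at the seam, and restore the
inequalities `fᵢ₋₁ ≤ (xᵢ fᵢ)⁺` to the left of the seam. -/
protected def mul : Chain X → Chain X → Chain X
  | single f, single g => single (f ⊓ g)
  | single f, cons g x n => cons (f ⊓ g) x n
  | cons f x m, n => cons (f ⊓ op x (m.mul n).head) x (m.mul n)

instance : Mul (Chain X) := ⟨Chain.mul⟩

@[simp] theorem head_single (f : Proj X) : (single f).head = f := rfl

@[simp] theorem head_cons (f : Proj X) (x : X) (m : Chain X) : (cons f x m).head = f := rfl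

@[simp] theorem length_single (f : Proj X) : (single f).length = 0 := rfl

@[simp] theorem length_cons (f : Proj X) (x : X) (m : Chain X) :
    (cons f x m).length = m.length + 1 := rfl

@[simp] theorem single_mul_single (f g : Proj X) : single f * single g = single (f ⊓ g) := rfl

@[simp] theorem single_mul_cons (f g : Proj X) (x : X) (m : Chain X) :
    single f * cons g x m = cons (f ⊓ g) x m := rfl

@[simp] theorem cons_mul (f : Proj X) (x : X) (m n : Chain X) :
    cons f x m * n = cons (f ⊓ op x (m * n).head) x (m * n) := rfl

@[simp] theorem head_single_mul (f : Proj X) (m : Chain X) :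
    (single f * m).head = f ⊓ m.head := by
  cases m <;> rfl

theorem head_mul_le (m n : Chain X) : (m * n).head ≤ m.head := by
  cases m with
  | single f => exact (head_single_mul f n).trans_le inf_le_left
  | cons f x m => exact inf_le_left

@[simp] theorem length_mul (m n : Chain X) : (m * n).length = m.length + n.length := by
  induction m with
  | single f => cases n <;> simp
  | cons f x m ih => simp [ih, add_right_comm]

instance : Semigroup (Chain X) where
  mul_assoc m n k := by
    induction m with
    | single f => cases n <;> cases k <;> simp [inf_assoc]
    | cons f x m ih =>
      have h : op x (m * (n * k)).head ≤ op x (m * n).head :=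
        op_mono x (ih ▸ head_mul_le (m * n) k)
      simp [ih, inf_assoc, inf_eq_right.2 h]

theorem single_mul_of_head_le {f : Proj X} {m : Chain X} (h : m.head ≤ f) : single f * m = m := by
  cases m <;> simpa using h

theorem mul_single_of_final_le {m : Chain X} (hm : m.IsNormal) {f : Proj X} (hf : m.final ≤ f) :
    m * single f = m := by
  induction m with
  | single g => simpa [final] using hf
  | cons g x m ih => simp [ih hm.2 hf, hm.1]

theorem head_mul_single_head (m n : Chain X) : (m * single n.head).head = (m * n).head := by
  induction m with
  | single f => simp
  | cons f x m ih => simp [ih]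

theorem IsNormal.mul (m : Chain X) {n : Chain X} (hn : n.IsNormal) : (m * n).IsNormal := by
  induction m with
  | single f =>
    cases n with
    | single g => trivial
    | cons g x n => exact ⟨inf_le_right.trans hn.1, hn.2⟩
  | cons f x m ih => exact ⟨inf_le_right, ih⟩

end Chain

/-- Normal chains. They form the free left Ehresmann monoid, the letters being the chains
`(x⁺, x, 1)`. -/
def NormalChain (X : Type*) : Type _ := {m : Chain X // m.IsNormal}

namespace NormalChain

open Proj Chain LeftEhresmannMonoid

variable {X : Type*}

/-- A projection as a chain without letters. -/
def ofProj (f : Proj X) : NormalChain X := ⟨single f, trivial⟩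

/-- The generator of the monoid of normal chains given by a letter. -/
def of (x : X) : NormalChain X := ⟨cons (op x ⊤) x (single ⊤), le_rfl, trivial⟩

instance : LeftEhresmannMonoid (NormalChain X) where
  mul m n := ⟨m.1 * n.1, n.2.mul m.1⟩
  one := ofProj ⊤
  mul_assoc m n k := Subtype.ext (mul_assoc m.1 n.1 k.1)
  one_mul m := Subtype.ext (single_mul_of_head_le le_top)
  mul_one m := Subtype.ext (mul_single_of_final_le m.2 le_top)
  plus m := ofProj m.1.head
  plus_mul_self m := Subtype.ext (single_mul_of_head_le le_rfl)
  plus_mul_comm m n := congrArg ofProj (inf_comm m.1.head n.1.head)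
  plus_plus_mul_plus m n := rfl
  plus_mul_plus m n := congrArg ofProj (head_mul_single_head m.1 n.1)

theorem ofProj_op (x : X) (f : Proj X) : ofProj (op x f) = plus (of x * ofProj f) := by
  refine congrArg ofProj (Eq.symm ?_)
  change op x ⊤ ⊓ op x (⊤ ⊓ f) = op x f
  rw [top_inf_eq, inf_eq_right.2 (op_mono x le_top)]

theorem mk_cons (f : Proj X) (x : X) (m : Chain X) (h : (cons f x m).IsNormal) :
    (⟨cons f x m, h⟩ : NormalChain X) = ofProj f * (of x * ⟨m, h.2⟩) := by
  refine Subtype.ext ?_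
  change cons f x m = single f * (cons (op x ⊤) x (single ⊤) * m)
  rw [cons_mul, single_mul_of_head_le le_top, single_mul_cons, inf_eq_right.2 (op_mono x le_top),
    inf_eq_left.2 h.1]

@[elab_as_elim]
theorem induction {P : NormalChain X → Prop} (one : P 1) (of : ∀ x, P (of x))
    (mul : ∀ m n, P m → P n → P (m * n)) (plus : ∀ m, P m → P (plus m)) (m : NormalChain X) :
    P m := by
  have ofProj (f : Proj X) : P (ofProj f) := by
    induction f using Proj.induction with
    | top => exact one
    | inf e f he hf => exact mul _ _ he hf
    | op x e he => exact ofProj_op x e ▸ plus _ (mul _ _ (of x) he)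
  obtain ⟨m, hm⟩ := m
  induction m with
  | single f => exact ofProj f
  | cons f x m ih => exact mk_cons f x m hm ▸ mul _ _ (ofProj f) (mul _ _ (of x) (ih hm.2))

end NormalChain

/-! ### Freeness of the monoid of normal chains -/

section Lift

open LeftEhresmannMonoid

variable {X M : Type*} [LeftEhresmannMonoid M] (f : X → M)

namespace Proj

/-- The interpretation of projections in a left Ehresmann monoid containing the letters. -/
def eval : InfTopHom (Proj X) (Projection M) := lift fun x => Projection.act (f x)

theorem eval_inf (e g : Proj X) : (eval f (e ⊓ g)).1 = (eval f e).1 * (eval f g).1 := by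
  rw [map_inf, Projection.val_inf]

theorem eval_op (x : X) (e : Proj X) : (eval f (op x e)).1 = plus (f x * (eval f e).1) :=
  congrArg Subtype.val (lift_op (L := Projection M) _ x e)

end Proj

namespace Chain

/-- The product of the entries of a chain in a left Ehresmann monoid containing the letters. -/
def eval : Chain X → M
  | single e => (Proj.eval f e).1
  | cons e x m => (Proj.eval f e).1 * (f x * m.eval)

theorem plus_eval {m : Chain X} (hm : m.IsNormal) :
    plus (m.eval f) = (Proj.eval f m.head).1 := by
  induction m with
  | single e => exact (Proj.eval f e).2
  | cons e x m ih =>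
    calc plus ((Proj.eval f e).1 * (f x * m.eval f))
        = (Proj.eval f e).1 * (Proj.eval f (Proj.op x m.head)).1 := by
          rw [plus_mul_of_plus_eq (Proj.eval f e).2, ← plus_mul_plus, ih hm.2, Proj.eval_op]
      _ = (Proj.eval f e).1 := by rw [← Proj.eval_inf, inf_eq_left.2 hm.1]

theorem eval_mul (m : Chain X) {n : Chain X} (hn : n.IsNormal) :
    (m * n).eval f = m.eval f * n.eval f := by
  induction m with
  | single e =>
    cases n with
    | single g => exact Proj.eval_inf f e g
    | cons g x n => simp only [single_mul_cons, eval, Proj.eval_inf, mul_assoc]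
  | cons e x m ih =>
    calc (Proj.eval f (e ⊓ Proj.op x (m * n).head)).1 * (f x * (m * n).eval f)
        = (Proj.eval f e).1 *
            (plus (f x * (m * n).eval f) * (f x * (m * n).eval f)) := by
          rw [Proj.eval_inf, Proj.eval_op, ← plus_eval f (hn.mul m), plus_mul_plus, mul_assoc]
      _ = (Proj.eval f e).1 * (f x * m.eval f) * n.eval f := by
          rw [plus_mul_self, ih, mul_assoc, mul_assoc]

end Chain

namespace NormalChain

/-- The extension of a map from the letters to a homomorphism on normal chains. -/
def lift : NormalChain X →* M where
  toFun m := m.1.eval f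
  map_one' := congrArg Subtype.val (map_top (Proj.eval f))
  map_mul' m n := m.1.eval_mul f n.2

theorem lift_plus (m : NormalChain X) : lift f (plus m) = plus (lift f m) :=
  (Chain.plus_eval f m.2).symm

theorem lift_of (x : X) : lift f (of x) = f x := by
  have map_top : (Proj.eval f ⊤).1 = 1 := congrArg Subtype.val (map_top (Proj.eval f))
  change (Proj.eval f (Proj.op x ⊤)).1 * (f x * (Proj.eval f ⊤).1) = f x
  rw [Proj.eval_op, map_top, mul_one, plus_mul_self]

end NormalChain

end Lift

namespace NormalChain

open LeftEhresmannMonoid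

theorem nonempty_mulEquiv_FLAd (X : Type*) : Nonempty (FLAd X ≃* NormalChain X) := by
  obtain ⟨φ, ⟨hφ_plus, hφ_of⟩, -⟩ := FLAd.existsUnique_lift (of (X := X))
  have left_inverse : (lift FLAd.of).comp φ = MonoidHom.id (FLAd X) :=
    (FLAd.existsUnique_lift FLAd.of).unique
      ⟨fun a => by simp [hφ_plus, lift_plus], fun x => by simp [hφ_of, lift_of]⟩
      ⟨fun _ => rfl, fun _ => rfl⟩
  have surjective (m : NormalChain X) : ∃ a, φ a = m := by
    induction m using NormalChain.induction with
    | one => exact ⟨1, map_one φ⟩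
    | of x => exact ⟨FLAd.of x, hφ_of x⟩
    | mul m n hm hn =>
      obtain ⟨⟨a, rfl⟩, b, rfl⟩ := And.intro hm hn
      exact ⟨a * b, map_mul φ a b⟩
    | plus m hm =>
      obtain ⟨a, rfl⟩ := hm
      exact ⟨plus a, hφ_plus a⟩
  have injective : Function.Injective φ :=
    Function.LeftInverse.injective (g := lift FLAd.of) (DFunLike.congr_fun left_inverse)
  exact ⟨MulEquiv.ofBijective φ ⟨injective, surjective⟩⟩

end NormalChain

/-! ### Cancellation and divisibility of chains -/

namespace Chain

open Proj

variable {X : Type*}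

theorem single_final_mul_eq_of_mul_eq {a u v : Chain X} (h : a * u = a * v) :
    single a.final * u = single a.final * v := by
  induction a with
  | single f => exact h
  | cons f x a ih => exact ih (Chain.cons.inj h).2.2

theorem single_mul_ne_cons_mul {a b v : Chain X} (hab : a.length ≤ b.length) (f g : Proj X)
    (x : X) : single f * a ≠ cons g x v * b := by
  intro h
  have hlength := congrArg length h
  simp only [length_mul, length_single, length_cons] at hlength
  omega

theorem mul_single_head_eq_of_mul_eq {a u v : Chain X} (h : u * a = v * a) :
    u * single a.head = v * single a.head := by
  induction u generalizing v with
  | single f =>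
    cases v with
    | single g => simpa using congrArg head h
    | cons g y v => exact (single_mul_ne_cons_mul le_rfl f g y h).elim
  | cons f x u ih =>
    cases v with
    | single g => exact (single_mul_ne_cons_mul le_rfl g f x h.symm).elim
    | cons g y v =>
      simp only [cons_mul, cons.injEq] at h
      obtain ⟨hfg, rfl, huv⟩ := h
      rw [cons_mul, cons_mul, head_mul_single_head, head_mul_single_head, ih huv, hfg]

theorem IsNormal.of_mul {a c : Chain X} (h : (a * c).IsNormal) :
    (single a.final * c).IsNormal := by
  induction a with
  | single f => exact h
  | cons f x a ih => exact ih h.2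

theorem single_dvd_iff {f : Proj X} {c : Chain X} : single f ∣ c ↔ c.head ≤ f := by
  refine ⟨?_, fun h => ⟨c, (single_mul_of_head_le h).symm⟩⟩
  rintro ⟨k, rfl⟩
  exact head_mul_le (single f) k

theorem not_cons_dvd_single {f g : Proj X} {x : X} {a : Chain X} : ¬ cons f x a ∣ single g := by
  rintro ⟨k, h⟩
  cases h

theorem cons_dvd_cons_iff {f g : Proj X} {x y : X} {a c : Chain X} :
    cons f x a ∣ cons g y c ↔ x = y ∧ g = f ⊓ op x c.head ∧ a ∣ c := by
  constructor
  · rintro ⟨k, h⟩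
    obtain ⟨rfl, rfl, rfl⟩ := Chain.cons.inj h
    exact ⟨rfl, rfl, k, rfl⟩
  · rintro ⟨rfl, rfl, k, rfl⟩
    exact ⟨k, rfl⟩

theorem dvd_mul_single_head_iff {a b : Chain X} (hab : a.length ≤ b.length) (v : Chain X) :
    a ∣ b * single v.head ↔ a ∣ b * v := by
  induction a generalizing b with
  | single f => rw [single_dvd_iff, single_dvd_iff, head_mul_single_head]
  | cons f x a ih =>
    cases b with
    | single g => simp at hab
    | cons g y b =>
      rw [cons_mul, cons_mul, cons_dvd_cons_iff, cons_dvd_cons_iff, head_mul_single_head,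
        ih (Nat.le_of_succ_le_succ hab)]

theorem emptyOrPrincipal_head_mul_le (q : Proj X) (m : Chain X) :
    EmptyOrPrincipal fun h => (m * single h).head ≤ q := by
  induction q using Proj.induction generalizing m with
  | top => exact .inr ⟨⊤, by simp⟩
  | inf e f he hf => simpa only [le_inf_iff] using (he m).and (hf m)
  | op x e he =>
    cases m with
    | single f =>
      simpa only [head_single_mul, head_single, inf_le_op_iff] using
        EmptyOrPrincipal.const_or (f ≤ op x e) (.inr ⟨op x e, fun _ => Iff.rfl⟩)
    | cons f y m =>
      simpa only [cons_mul, head_cons, inf_le_op_iff, op_le_op_iff] using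
        ((he m).const_and (y = x)).const_or (f ≤ op x e)

theorem emptyOrPrincipal_dvd_mul (a b : Chain X) : EmptyOrPrincipal fun h => a ∣ b * single h := by
  induction a generalizing b with
  | single f => simpa only [single_dvd_iff] using emptyOrPrincipal_head_mul_le f b
  | cons f x a ih =>
    cases b with
    | single g => exact .inl fun h => not_cons_dvd_single
    | cons g y b =>
      by_cases hxy : x = y
      · subst hxy
        simpa only [cons_mul, cons_dvd_cons_iff, head_cons, inf_eq_inf_iff_right, true_and,
          and_assoc] using (emptyOrPrincipal_head_mul_le g (cons f x b)).and
            ((emptyOrPrincipal_head_mul_le f (cons g x b)).and (ih b))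
      · exact .inl fun h hdvd => hxy (cons_dvd_cons_iff.1 hdvd).1

/-- The chain with its head replaced by the largest one that keeps it normal. -/
def sat : Chain X → Chain X
  | single _ => single ⊤
  | cons _ x m => cons (op x m.head) x m

theorem IsNormal.sat {m : Chain X} (hm : m.IsNormal) : m.sat.IsNormal := by
  cases m with
  | single f => trivial
  | cons f x m => exact ⟨le_rfl, hm.2⟩

theorem IsNormal.single_head_mul_sat {m : Chain X} (hm : m.IsNormal) :
    single m.head * m.sat = m := by
  cases m with
  | single f => simp [Chain.sat]
  | cons f x m => simp [Chain.sat, hm.1]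

theorem sat_single_mul (f : Proj X) (m : Chain X) : (single f * m).sat = m.sat := by
  cases m <;> rfl

theorem exists_eq_mul_or_sat_eq {a b u v : Chain X} (hb : b.IsNormal)
    (hab : a.length ≤ b.length) (h : u * a = v * b) : (∃ w, b = w * a) ∨ a.sat = b.sat := by
  induction u generalizing v with
  | single f =>
    cases v with
    | single g =>
      right
      rw [← sat_single_mul f a, h, sat_single_mul]
    | cons g y v => exact (single_mul_ne_cons_mul hab f g y h).elim
  | cons f x u ih =>
    cases v with
    | single g =>
      left
      cases b with
      | single k => cases h
      | cons k y b =>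
        simp only [cons_mul, single_mul_cons, cons.injEq] at h
        obtain ⟨-, rfl, rfl⟩ := h
        refine ⟨cons k x u, ?_⟩
        rw [cons_mul, inf_eq_left.2 hb.1]
    | cons g y v => exact ih (Chain.cons.inj h).2.2

end Chain

/-! ### Annihilators and intersections of principal ideals -/

namespace NormalChain

open Chain LeftEhresmannMonoid MulOpposite

variable {X : Type*}

theorem mul_plus_eq_of_mul_eq {a u v : NormalChain X} (h : u * a = v * a) :
    u * plus a = v * plus a :=
  Subtype.ext (mul_single_head_eq_of_mul_eq (congrArg Subtype.val h))

theorem finitelyEquated_left : FinitelyEquated (NormalChain X) (NormalChain X) := fun a =>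
  annihilatorCon_finitelyGenerated (plus_mul_self a) fun _ _ => mul_plus_eq_of_mul_eq

theorem finitelyEquated_right : FinitelyEquated (NormalChain X)ᵐᵒᵖ (NormalChain X) := fun a =>
  annihilatorCon_finitelyGenerated (e := op (ofProj a.1.final))
    (Subtype.ext (mul_single_of_final_le a.2 le_rfl)) fun _ _ h =>
      unop_injective (Subtype.ext (single_final_mul_eq_of_mul_eq (congrArg Subtype.val h)))

theorem exists_eq_mul_or_eq_plus_mul {a b u v : NormalChain X} (hab : a.1.length ≤ b.1.length)
    (h : u * a = v * b) :
    (∃ w, b = w * a) ∨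
      ∃ r, plus a * r = a ∧ plus b * r = b ∧ ∀ u v, u * r = v * r → u * plus r = v * plus r := by
  obtain ⟨w, hw⟩ | hsat := exists_eq_mul_or_sat_eq b.2 hab (congrArg Subtype.val h)
  · refine .inl ⟨⟨w * single ⊤, .mul w trivial⟩, Subtype.ext ?_⟩
    change b.1 = w * single ⊤ * a.1
    rw [mul_assoc, single_mul_of_head_le le_top, hw]
  · refine .inr ⟨⟨a.1.sat, a.2.sat⟩, Subtype.ext a.2.single_head_mul_sat, Subtype.ext ?_,
      fun _ _ => mul_plus_eq_of_mul_eq⟩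
    change single b.1.head * a.1.sat = b.1
    rw [hsat, b.2.single_head_mul_sat]

theorem howsonAct_left : HowsonAct (NormalChain X) (NormalChain X) := by
  intro a b
  wlog hab : a.1.length ≤ b.1.length generalizing a b
  · rw [inf_comm]
    exact this b a (le_of_not_ge hab)
  refine inf_closure_singleton_fg ?_
  rintro ⟨u₀, v₀, h₀⟩
  obtain ⟨w, hw⟩ | ⟨r, ha, hb, hcancel⟩ := exists_eq_mul_or_eq_plus_mul hab h₀
  · refine ⟨w, 1, hw.symm.trans (one_mul b).symm, fun u v h => ⟨v, ?_⟩⟩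
    calc v * (w * a) = v * b := by rw [hw]
      _ = u * a := h.symm
  · refine ⟨plus b, plus a, ?_, fun u v h => ⟨u, mul_plus_mul_eq_of_mul_eq_mul hcancel ha hb h⟩⟩
    calc plus b * a = plus b * (plus a * r) := by rw [ha]
      _ = plus a * (plus b * r) := by rw [← mul_assoc, plus_mul_comm, mul_assoc]
      _ = plus a * b := by rw [hb]

theorem dvd_iff {a b : NormalChain X} : a ∣ b ↔ a.1 ∣ b.1 := by
  constructor
  · rintro ⟨k, rfl⟩
    exact ⟨k.1, rfl⟩
  · rintro ⟨k, hk⟩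
    refine ⟨⟨single a.1.final * k, .of_mul (hk ▸ b.2)⟩, Subtype.ext ?_⟩
    change b.1 = a.1 * (single a.1.final * k)
    rw [← mul_assoc, mul_single_of_final_le a.2 le_rfl, hk]

theorem howsonAct_right : HowsonAct (NormalChain X)ᵐᵒᵖ (NormalChain X) := by
  intro a b
  wlog hab : a.1.length ≤ b.1.length generalizing a b
  · rw [inf_comm]
    exact this b a (le_of_not_ge hab)
  refine inf_closure_singleton_fg ?_
  rintro ⟨u₀, v₀, h₀⟩
  have dvd_mul_head {u v : (NormalChain X)ᵐᵒᵖ} (h : u • a = v • b) :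
      a.1 ∣ b.1 * single v.unop.1.head :=
    (dvd_mul_single_head_iff hab _).2 ⟨u.unop.1, congrArg Subtype.val h.symm⟩
  obtain hnot_dvd | ⟨q, hq⟩ := emptyOrPrincipal_dvd_mul a.1 b.1
  · exact (hnot_dvd _ (dvd_mul_head h₀)).elim
  obtain ⟨p, hp⟩ : a ∣ b * ofProj q := dvd_iff.2 ((hq q).2 le_rfl)
  refine ⟨op p, op (ofProj q), hp.symm, fun u v h => ⟨v, ?_⟩⟩
  have hv : ofProj q * v.unop = v.unop :=
    Subtype.ext (single_mul_of_head_le ((hq _).1 (dvd_mul_head h)))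
  calc a * p * v.unop = b * v.unop := by rw [← hp, mul_assoc, hv]
    _ = a * u.unop := h.symm

end NormalChain

theorem theorem6p1 (X : Type*) :
    WeaklyLeftCoherent (FLAd X) ∧ WeaklyRightCoherent (FLAd X) := by
  obtain ⟨e⟩ := NormalChain.nonempty_mulEquiv_FLAd X
  have weaklyLeftCoherent : WeaklyLeftCoherent (FLAd X) := by
    let f : FLAd X →ₑ[e] NormalChain X := ⟨e, map_mul e⟩
    exact fun _ => finitelyPresentedAct_of_finitelyEquated_of_howsonAct
      (NormalChain.finitelyEquated_left.of_injective e f e.injective)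
      (NormalChain.howsonAct_left.of_injective e f e.injective)
  have weaklyRightCoherent : WeaklyRightCoherent (FLAd X) := by
    let f : FLAd X →ₑ[MulEquiv.op e] NormalChain X := ⟨e, fun r a => map_mul e a r.unop⟩
    exact fun _ => finitelyPresentedAct_of_finitelyEquated_of_howsonAct
      (NormalChain.finitelyEquated_right.of_injective (MulEquiv.op e) f e.injective)
      (NormalChain.howsonAct_right.of_injective (MulEquiv.op e) f e.injective)
  exact ⟨weaklyLeftCoherent, weaklyRightCoherent⟩
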